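/- Let $L,T>0$, let $M\ge 1$ and $N\ge 0$ be integers, and put $\Omega=(-L,L)$, $\Delta x=L/M$, $\Delta t=T/(N+1)$, $t^n=n\Delta t$, $x_{i+1/2}=-L+i\Delta x$ for $0\le i\le 2M$, $C_i=[x_{i-1/2},x_{i+1/2})$ and $x_i=-L+(i-\tfrac12)\Delta x$ for $1\le i\le 2M$. Let $H\in C^2([0,\infty))$ with $H''(s)>0$ for $s>0$, let $V\in L^1(-L,L)$ and $W\in L^1(-2L,2L)$ (for instance, $V$ and $W$ of class $C^2$ on the closed intervals), and let $\rho_0\in L^1(\Omega)$ be non-negative. Write $(s)^+=\max\{s,0\}$, $(s)^-=\min\{s,0\}$, and $$V_i=\frac1{\Delta x}\int_{C_i}V(s)\,ds,\qquad W_{i-j}=\frac1{\Delta x}\int_{C_j}W(x_i-s)\,ds .$$ Fix one of the three choices $\rho^{**}=\rho^n$, $\rho^{**}=\rho^{n+1}$, $\rho^{**}=\tfrac12(\rho^n+\rho^{n+1})$. A family $(\rho_i^n)$, $1\le i\le 2M$, $0\le n\le N+1$, solves the implicit scheme if $\rho_i^0=\frac1{\Delta x}\int_{C_i}\rho_0\,dx$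 and, for $1\le i\le 2M$ and $0\le n\le N$, $$\frac{\rho_i^{n+1}-\rho_i^n}{\Delta t}=-\frac{F_{i+1/2}^{n+1}-F_{i-1/2}^{n+1}}{\Delta x},$$ where $F_{1/2}^{n+1}=F_{2M+1/2}^{n+1}=0$ and, for $1\le i\le 2M-1$, $$F_{i+1/2}^{n+1}=\rho_i^{n+1}(u_{i+1/2}^{n+1})^++\rho_{i+1}^{n+1}(u_{i+1/2}^{n+1})^-,\quad u_{i+1/2}^{n+1}=-\frac{\xi_{i+1}^{n+1}-\xi_i^{n+1}}{\Delta x},\quad \xi_i^{n+1}=H'(\rho_i^{n+1})+V_i+\sum_{j=1}^{2M}W_{i-j}\,\rho_j^{**}\,\Delta x .$$ Then the following hold, with no restriction on the mesh. 1. The scheme has a non-negative solution $(\rho_i^n)$. 2. Every non-negative solution conserves the mass: if $\rho_h(t,x)=\rho_i^n$ for $t\in[t^n,t^{n+1})$ and $x\in C_i$ (the level $n=N+1$ giving the value at $t=T$), then $\|\rho_h(t,\cdot)\|_{L^1(\Omega)}=\|\rho_0\|_{L^1(\Omega)}$ for all $t\in[0,T]$. 3. If $\rho^{**}=\rho^n$,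 or if $W=0$ on $(-2L,2L)$, then the non-negative solution is unique. -/

import Mathlib

open MeasureTheory

noncomputable section

namespace FiniteVolume

/-- A uniform mesh of `(0, T) × (-L, L)`: `2 * M` space cells and `N + 1` time intervals. -/
structure Mesh where
  L : ℝ
  T : ℝ
  M : ℕ
  N : ℕ
  L_pos : 0 < L
  T_pos : 0 < T
  M_pos : 0 < M

namespace Mesh

variable (m : Mesh)

/-- The space domain `Ω = (-L, L)`. -/
def domain : Set ℝ := Set.Ioo (-m.L) m.L

/-- The cell length `Δx = L / M`. -/
def dx : ℝ := m.L / m.M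

/-- The time step `Δt = T / (N + 1)`. -/
def dt : ℝ := m.T / (m.N + 1)

/-- A density on the mesh. The cells are numbered from `0` to `2 * M - 1`. -/
abbrev State : Type := Fin (2 * m.M) → ℝ

/-- The cell number `i` (counted from `0`): `[-L + i Δx, -L + (i + 1) Δx)`. -/
def cell (i : Fin (2 * m.M)) : Set ℝ :=
  Set.Ico (-m.L + (i : ℝ) * m.dx) (-m.L + ((i : ℝ) + 1) * m.dx)

/-- The centre of the cell number `i`. -/
def center (i : Fin (2 * m.M)) : ℝ := -m.L + ((i : ℝ) + 1 / 2) * m.dx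

/-- The time interval `[t^n, t^{n+1})`, with `t^n = n Δt`. -/
def timeInterval (n : ℕ) : Set ℝ := Set.Ico ((n : ℝ) * m.dt) (((n : ℝ) + 1) * m.dt)

/-- The cell averages of a function on `Ω`. -/
def cellAverage (f : ℝ → ℝ) : m.State := fun i => ⨍ s in m.cell i, f s

/-- The discrete interaction kernel: the average over the cell `j` of `W (x_i - s)`. -/
def kernel (W : ℝ → ℝ) (i j : Fin (2 * m.M)) : ℝ := ⨍ s in m.cell j, W (m.center i - s)

/-- The discrete convolution `(W * η)_i`. -/
def conv (W : ℝ → ℝ) (η : m.State) : m.State := fun i => ∑ j, m.kernel W i j * η j * m.dx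

end Mesh

/-- The three choices of the density `ρ**` in the interaction term. -/
inductive InteractionChoice
  | old
  | new
  | midpoint

/-- The density `ρ**` built from `ρ = ρ^n` and `θ = ρ^{n+1}`. -/
def InteractionChoice.density {ι : Type} (c : InteractionChoice) (ρ θ : ι → ℝ) : ι → ℝ :=
  match c with
  | .old => ρ
  | .new => θ
  | .midpoint => fun i => (ρ i + θ i) / 2

namespace Mesh

variable (m : Mesh)

/-- The discrete entropy variables `ξ_i = H'(θ_i) + V_i + (W * ρ**)_i`, where `ρ = ρ^n`,
`θ = ρ^{n+1}` and `H'` is the derivative on `[0, ∞)` (one-sided at `0`). -/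
def entropyVar (H V W : ℝ → ℝ) (c : InteractionChoice) (ρ θ : m.State) : m.State := fun i =>
  derivWithin H (Set.Ici 0) (θ i) + m.cellAverage V i + m.conv W (c.density ρ θ) i

/-- The upwind flux through the interface `-L + k Δx`, `k = 0, …, 2 * M`, which lies between the
cells number `k - 1` and `k`. It is zero at the two ends of the domain. -/
def flux (H V W : ℝ → ℝ) (c : InteractionChoice) (ρ θ : m.State) (k : ℕ) : ℝ :=
  if h : 0 < k ∧ k < 2 * m.M then
    let l : Fin (2 * m.M) := ⟨k - 1, by omega⟩
    let r : Fin (2 * m.M) := ⟨k, h.2⟩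
    let u : ℝ := -((m.entropyVar H V W c ρ θ r - m.entropyVar H V W c ρ θ l) / m.dx)
    θ l * max u 0 + θ r * min u 0
  else 0

/-- `ρ = (ρ^n_i)`, with time levels `n = 0, …, N + 1`, is a solution of the implicit scheme with
initial datum `ρ₀`. -/
structure IsSolution (H V W : ℝ → ℝ) (c : InteractionChoice) (ρ₀ : ℝ → ℝ)
    (ρ : Fin (m.N + 2) → m.State) : Prop where
  initial : ρ 0 = m.cellAverage ρ₀
  step : ∀ (n : Fin (m.N + 1)) (i : Fin (2 * m.M)),
    (ρ n.succ i - ρ n.castSucc i) / m.dt =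
      -((m.flux H V W c (ρ n.castSucc) (ρ n.succ) ((i : ℕ) + 1)
        - m.flux H V W c (ρ n.castSucc) (ρ n.succ) (i : ℕ)) / m.dx)

/-- A non-negative solution of the implicit scheme. -/
def IsNonnegSolution (H V W : ℝ → ℝ) (c : InteractionChoice) (ρ₀ : ℝ → ℝ)
    (ρ : Fin (m.N + 2) → m.State) : Prop :=
  m.IsSolution H V W c ρ₀ ρ ∧ ∀ n i, 0 ≤ ρ n i

open Classical in
/-- The piecewise constant interpolation: `ρ^n_i` for `t ∈ [t^n, t^{n+1})` and `x` in the cell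
`i`. The last level `n = N + 1` gives the value at `t = T`. -/
def interpolation (ρ : Fin (m.N + 2) → m.State) (t x : ℝ) : ℝ :=
  ∑ n : Fin (m.N + 2), ∑ i, if t ∈ m.timeInterval (n : ℕ) ∧ x ∈ m.cell i then ρ n i else 0

end Mesh

end FiniteVolume

end

/-! Each time step is treated as a nonlinear system for the new density, and the upwind flux alone
gives all three claims.

Existence: the flux differences telescope, so the residual of a step is tangent to the simplex of
non-negative densities with the mass of `ρ`. On a face, an empty cell can lose nothing, so the
residual has a sign there. A fixed point of a Nash-type map on the simplex is then a zero
(`exists_zero_of_nonpos_on_faces`). Only continuity of the flux is used, hence no mesh restriction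
and all choices of `ρ**` at once. The fixed point comes from Brouwer's theorem, proved analytically:
the volume integral of `det (1 + t Dk)` is polynomial in `t` and constant for small `t`, which
excludes a smooth retraction onto a sphere.

Mass: the same telescoping preserves the sum over the cells, which is the L¹ norm up to `Δx` because
the densities are non-negative.

Uniqueness: when the interaction term does not involve the new density, monotonicity of `H'` makes
the flux nondecreasing in the left density and nonincreasing in the right one. Testing the
difference of two steps with the indicator of `η < θ` yields `∑ (θ - η)⁺ ≤ 0` (`IsStep.le`), and
exchanging the roles gives equality. -/

/-! ### Brouwer's fixed point theorem by a volume argument -/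

section Brouwer

open Metric Polynomial Topology

theorem LinearMap.exists_polynomial_eval_eq_det_one_add_smul {E : Type*} [AddCommGroup E]
    [Module ℝ E] [FiniteDimensional ℝ E] (A : E →ₗ[ℝ] E) :
    ∃ q : ℝ[X], q.degree < ((Module.finrank ℝ E + 1 : ℕ) : WithBot ℕ) ∧
      ∀ t : ℝ, q.eval t = LinearMap.det (1 + t • A) := by
  classical
  let b := Module.finBasis ℝ E
  let B := LinearMap.toMatrix b b A
  refine ⟨((X : ℝ[X]) • B.map C + (1 : Matrix _ _ ℝ).map C).det, ?_, fun t => ?_⟩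
  · refine lt_of_le_of_lt degree_le_natDegree ?_
    have := natDegree_det_X_add_C_le B 1
    rw [Fintype.card_fin] at this
    exact_mod_cast Nat.lt_succ_of_le this
  · rw [← LinearMap.det_toMatrix b, ← coe_evalRingHom, RingHom.map_det]
    congr 1
    ext i j
    simp only [RingHom.mapMatrix_apply, Matrix.map_apply, Matrix.add_apply, Matrix.smul_apply,
      map_add, LinearMap.toMatrix_one, map_smul, smul_eq_mul, coe_evalRingHom, eval_mul,
      eval_X, eval_C, B]
    rw [add_comm]

/-- A Lipschitz function on a closed ball that vanishes on the sphere stays Lipschitz when it is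
extended by zero. -/
theorem LipschitzOnWith.indicator_closedBall {E F : Type*} [NormedAddCommGroup E]
    [NormedSpace ℝ E] [NormedAddCommGroup F] {k : E → F} {r : ℝ} {K : NNReal}
    (hk : LipschitzOnWith K k (closedBall 0 r)) (h0 : ∀ x, ‖x‖ = r → k x = 0) :
    LipschitzWith K ((closedBall (0 : E) r).indicator k) := by
  classical
  -- The segment from `x` to `y` meets the sphere, where `k` vanishes, at a point no farther from
  -- `x` than `y` is.
  have key : ∀ x y : E, ‖x‖ ≤ r → r < ‖y‖ → ‖k x‖ ≤ K * ‖x - y‖ := by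
    intro x y hx hy
    have hc : ContinuousOn (fun t : ℝ => ‖x + t • (y - x)‖) (Set.Icc 0 1) := by fun_prop
    obtain ⟨t, ht, hz⟩ := intermediate_value_Icc (zero_le_one' ℝ) hc
      (show r ∈ Set.Icc _ _ by simpa using ⟨hx, hy.le⟩)
    simp only at hz
    have := hk.norm_sub_le (x := x) (y := x + t • (y - x)) (by simpa using hx) (by simp [hz])
    rw [h0 _ hz, sub_zero] at this
    refine this.trans ?_
    gcongr
    have h2 : x - (x + t • (y - x)) = t • (x - y) := by module
    rw [h2, norm_smul, Real.norm_of_nonneg ht.1]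
    exact mul_le_of_le_one_left (norm_nonneg _) ht.2
  refine LipschitzWith.of_dist_le_mul fun x y => ?_
  rw [dist_eq_norm, dist_eq_norm]
  by_cases hx : ‖x‖ ≤ r <;> by_cases hy : ‖y‖ ≤ r
  · simp only [Set.indicator, mem_closedBall_zero_iff, hx, hy, if_true]
    exact hk.norm_sub_le (by simpa using hx) (by simpa using hy)
  · simp only [Set.indicator, mem_closedBall_zero_iff, hx, hy, if_true, if_false, sub_zero]
    exact key x y hx (not_le.1 hy)
  · simp only [Set.indicator, mem_closedBall_zero_iff, hx, hy, if_true, if_false, zero_sub,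
      norm_neg]
    rw [norm_sub_rev]
    exact key y x hy (not_le.1 hx)
  · simp only [Set.indicator, mem_closedBall_zero_iff, hx, hy, if_false, sub_zero, norm_zero]
    positivity

variable {E : Type*} [NormedAddCommGroup E] [InnerProductSpace ℝ E] [FiniteDimensional ℝ E]

/-- A perturbation of the identity that is small in Lipschitz norm and supported in a ball maps
this ball bijectively onto itself. -/
theorem LipschitzOnWith.bijOn_closedBall_add_smul {k : E → E} {r t : ℝ} {K : NNReal}
    (hk : LipschitzOnWith K k (closedBall 0 r)) (h0 : ∀ x, ‖x‖ = r → k x = 0)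
    (ht : 0 ≤ t) (htK : t * K < 1) :
    Set.BijOn (fun x => x + t • k x) (closedBall 0 r) (closedBall 0 r) := by
  set k' := (closedBall (0 : E) r).indicator k with hk'
  have hL : LipschitzWith K k' := hk.indicator_closedBall h0
  set ψ : E → E := fun x => x + t • k' x with hψ
  have happ : ApproximatesLinearOn ψ ((ContinuousLinearEquiv.refl ℝ E : E ≃L[ℝ] E) : E →L[ℝ] E)
      Set.univ (t.toNNReal * K) := by
    intro x _ y _
    have h1 : ψ x - ψ y - (x - y) = t • (k' x - k' y) := by simp only [hψ]; module
    have h2 := hL.norm_sub_le x y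
    simp only [ContinuousLinearEquiv.coe_refl, ContinuousLinearMap.coe_id', id_eq]
    rw [h1, norm_smul, Real.norm_of_nonneg ht, NNReal.coe_mul, Real.coe_toNNReal _ ht, mul_assoc]
    gcongr
  -- The identity has norm 1 only on a nontrivial space, hence the separate case.
  have hc : Subsingleton E ∨ t.toNNReal * K <
      ‖((ContinuousLinearEquiv.refl ℝ E).symm : E →L[ℝ] E)‖₊⁻¹ := by
    rcases subsingleton_or_nontrivial E with h | h
    · exact Or.inl h
    · right
      have : ‖((ContinuousLinearEquiv.refl ℝ E).symm : E →L[ℝ] E)‖₊ = 1 := by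
        ext
        simp
      rw [this, inv_one, ← NNReal.coe_lt_coe, NNReal.coe_mul, Real.coe_toNNReal _ ht]
      simpa using htK
  have hinj : Function.Injective ψ := Set.injOn_univ.1 (happ.injOn hc)
  have hsurj : Function.Surjective ψ := happ.surjective hc
  have hout : ∀ x, x ∉ closedBall (0 : E) r → ψ x = x := by
    intro x hx
    simp [hψ, hk', Set.indicator_of_notMem hx]
  -- If `ψ x` were outside the ball, it would be fixed by `ψ`, and injectivity would give `ψ x = x`.
  have hmaps : Set.MapsTo ψ (closedBall 0 r) (closedBall 0 r) := by
    intro x hx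
    by_contra h
    have := hinj (hout _ h)
    rw [this] at h
    exact h hx
  have hB : Set.BijOn ψ (closedBall 0 r) (closedBall 0 r) := by
    refine ⟨hmaps, hinj.injOn, fun y hy => ?_⟩
    obtain ⟨x, rfl⟩ := hsurj y
    refine ⟨x, ?_, rfl⟩
    by_contra h
    rw [hout x h] at hy
    exact h hy
  refine hB.congr fun x hx => ?_
  simp [hψ, hk', Set.indicator_of_mem hx]

/-- For small `t` the map `x + t k x` is a bijection of the ball with positive Jacobian, so the
change of variables formula applies without absolute value. -/
theorem exists_forall_integral_det_one_add_smul_fderiv_eq [MeasurableSpace E] [BorelSpace E]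
    (μ : Measure E) [μ.IsAddHaarMeasure] {k : E → E} {r : ℝ} (hk : ContDiff ℝ 1 k)
    (h0 : ∀ x, ‖x‖ = r → k x = 0) :
    ∃ t₀ : ℝ, 0 < t₀ ∧ ∀ t ∈ Set.Icc 0 t₀,
      ∫ x in closedBall 0 r, (1 + t • fderiv ℝ k x).det ∂μ = μ.real (closedBall 0 r) := by
  have hcomp : IsCompact (closedBall (0 : E) r) := isCompact_closedBall 0 r
  obtain ⟨K, hK⟩ := (hk.locallyLipschitz.locallyLipschitzOn
    (s := closedBall 0 r)).exists_lipschitzOnWith_of_compact hcomp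
  have hdet : Continuous fun p : ℝ × E => (1 + p.1 • fderiv ℝ k p.2).det := by
    have h1 : Continuous (fderiv ℝ k) := hk.continuous_fderiv one_ne_zero
    exact ContinuousLinearMap.continuous_det.comp (by fun_prop)
  have hpos : ∀ᶠ t : ℝ in 𝓝 0, ∀ x ∈ closedBall (0 : E) r, 0 < (1 + t • fderiv ℝ k x).det := by
    refine hcomp.eventually_forall_of_forall_eventually fun x _ => ?_
    refine hdet.continuousAt.eventually (lt_mem_nhds ?_)
    simp [ContinuousLinearMap.det]
  have hK1 : ∀ᶠ t : ℝ in 𝓝 0, t * K < 1 := by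
    have : Continuous fun t : ℝ => t * K := by fun_prop
    exact this.continuousAt.eventually (gt_mem_nhds (by simp))
  obtain ⟨ε, hε, hball⟩ := Metric.eventually_nhds_iff.1 (hpos.and hK1)
  refine ⟨ε / 2, by positivity, fun t ht => ?_⟩
  obtain ⟨hp, hKt⟩ := hball (y := t) (by
    rw [Real.dist_eq, sub_zero, abs_of_nonneg ht.1]; linarith [ht.2])
  have hbij := hK.bijOn_closedBall_add_smul h0 ht.1 hKt
  have hvol := lintegral_abs_det_fderiv_eq_addHaar_image μ (s := closedBall (0 : E) r)
    (f := fun x => x + t • k x) (f' := fun x => 1 + t • fderiv ℝ k x)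
    measurableSet_closedBall (fun x _ => by
      have := (hk.differentiable one_ne_zero x).hasFDerivAt
      exact ((hasFDerivAt_id x).add (this.const_smul t)).hasFDerivWithinAt) hbij.injOn
  rw [hbij.image_eq] at hvol
  rw [integral_eq_lintegral_of_nonneg_ae, Measure.real, ← hvol]
  · congr 1
    refine setLIntegral_congr_fun measurableSet_closedBall fun x hx => ?_
    rw [abs_of_pos (hp x hx)]
  · filter_upwards [ae_restrict_mem measurableSet_closedBall] with x hx using (hp x hx).le
  · exact (hdet.comp (by fun_prop : Continuous fun x : E => (t, x))).aestronglyMeasurable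

/-- The integral is a polynomial in `t` of degree at most the dimension and is constant on `[0,
t₀]`, hence also at `t = 1`, where the map itself need not be injective. -/
theorem integral_det_one_add_fderiv_eq [MeasurableSpace E] [BorelSpace E]
    (μ : Measure E) [μ.IsAddHaarMeasure] {k : E → E} {r : ℝ} (hk : ContDiff ℝ 1 k)
    (h0 : ∀ x, ‖x‖ = r → k x = 0) :
    ∫ x in closedBall 0 r, (1 + fderiv ℝ k x).det ∂μ = μ.real (closedBall 0 r) := by
  obtain ⟨t₀, ht₀, h⟩ := exists_forall_integral_det_one_add_smul_fderiv_eq μ hk h0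
  set s := Finset.range (Module.finrank ℝ E + 1) with hs
  let v : ℕ → ℝ := fun j => t₀ / (j + 1)
  have hv : Set.InjOn v s := by
    intro i _ j _ hij
    have hi : (i : ℝ) + 1 ≠ 0 := by positivity
    have hj : (j : ℝ) + 1 ≠ 0 := by positivity
    simp only [v] at hij
    rw [div_eq_div_iff hi hj] at hij
    have := mul_left_cancel₀ ht₀.ne' hij
    exact_mod_cast (add_right_cancel this).symm
  have hvmem : ∀ j, v j ∈ Set.Icc 0 t₀ := fun j =>
    ⟨by positivity, div_le_self ht₀.le (by linarith [(Nat.cast_nonneg j : (0 : ℝ) ≤ j)])⟩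
  -- Extrapolation from the nodes `v j` to 1. The weights do not depend on `A`, so the identity can
  -- be integrated in `x` without handling the coefficients of the polynomial.
  have hint : ∀ A : E →L[ℝ] E,
      (1 + A).det = ∑ j ∈ s, (1 + v j • A).det * (Lagrange.basis s v j).eval 1 := by
    intro A
    obtain ⟨q, hq, hqe⟩ := LinearMap.exists_polynomial_eval_eq_det_one_add_smul (A : E →ₗ[ℝ] E)
    have hq' := Lagrange.eq_interpolate hv (f := q) (by simpa [hs] using hq)
    have h1 := congrArg (Polynomial.eval 1) hq'
    rw [Lagrange.interpolate_apply, Polynomial.eval_finsetSum] at h1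
    simp only [eval_mul, eval_C, hqe, one_smul] at h1
    exact h1
  have hone : ∑ j ∈ s, (Lagrange.basis s v j).eval 1 = 1 := by
    rw [← Polynomial.eval_finsetSum, Lagrange.sum_basis hv (by simp [hs]), eval_one]
  have hcont : Continuous (fderiv ℝ k) := hk.continuous_fderiv one_ne_zero
  calc ∫ x in closedBall 0 r, (1 + fderiv ℝ k x).det ∂μ
      = ∫ x in closedBall 0 r, ∑ j ∈ s,
          (1 + v j • fderiv ℝ k x).det * (Lagrange.basis s v j).eval 1 ∂μ := by
        simp_rw [← hint]
    _ = ∑ j ∈ s, ∫ x in closedBall 0 r,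
          (1 + v j • fderiv ℝ k x).det * (Lagrange.basis s v j).eval 1 ∂μ := by
        refine integral_finsetSum _ fun j _ => ?_
        refine ContinuousOn.integrableOn_compact (isCompact_closedBall 0 r) ?_
        refine Continuous.continuousOn (Continuous.mul ?_ continuous_const)
        exact ContinuousLinearMap.continuous_det.comp (by fun_prop)
    _ = ∑ j ∈ s, μ.real (closedBall 0 r) * (Lagrange.basis s v j).eval 1 := by
        refine Finset.sum_congr rfl fun j _ => ?_
        rw [integral_mul_const, h _ (hvmem j)]
    _ = μ.real (closedBall 0 r) := by rw [← Finset.mul_sum, hone, mul_one]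

/-- Since `‖h‖` is constant, the range of `Dh x` is orthogonal to `h x ≠ 0`, so `det Dh = 0`. With
`k = h - id` the volume of the ball would be zero. -/
theorem false_of_contDiff_retraction_sphere {h : E → E} {r : ℝ} (hr : 0 < r)
    (hh : ContDiff ℝ 1 h) (hnorm : ∀ x, ‖h x‖ = r) (hid : ∀ x, ‖x‖ = r → h x = x) : False := by
  borelize E
  let μ : Measure E := Measure.addHaar
  have key := integral_det_one_add_fderiv_eq μ (k := fun x => h x - x) (r := r)
    (hh.sub contDiff_id) (fun x hx => by simp [hid x hx])
  have hdet : ∀ x, (1 + fderiv ℝ (fun x => h x - x) x).det = 0 := by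
    intro x
    have hd := (hh.differentiable one_ne_zero x).hasFDerivAt
    have h1 : fderiv ℝ (fun x => h x - x) x = fderiv ℝ h x - 1 :=
      (hd.sub (hasFDerivAt_id x)).fderiv
    rw [h1, add_sub_cancel]
    have horth : ∀ w, inner ℝ (h x) (fderiv ℝ h x w) = 0 := by
      intro w
      have h2 := hd.norm_sq
      have h3 : (fun y => ‖h y‖ ^ 2) = fun _ => r ^ 2 := by simp [hnorm]
      rw [h3] at h2
      have h4 := congrArg (fun L => L w) (h2.unique (hasFDerivAt_const _ _))
      simpa using h4
    by_contra hne
    have hsurj : Function.Surjective (fderiv ℝ h x) := by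
      have hu : IsUnit (LinearMap.det (fderiv ℝ h x : E →ₗ[ℝ] E)) := isUnit_iff_ne_zero.2 hne
      exact (LinearEquiv.ofIsUnitDet (f := (fderiv ℝ h x : E →ₗ[ℝ] E)) (v := Module.finBasis ℝ E)
        (v' := Module.finBasis ℝ E) (by simpa using hu)).surjective
    obtain ⟨w, hw⟩ := hsurj (h x)
    have h5 := horth w
    rw [hw, inner_self_eq_zero] at h5
    have h6 := hnorm x
    rw [h5, norm_zero] at h6
    exact hr.ne h6
  simp only [hdet, integral_zero] at key
  have hpos : 0 < μ.real (closedBall (0 : E) r) :=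
    ENNReal.toReal_pos (measure_closedBall_pos μ _ hr).ne' measure_closedBall_lt_top.ne
  exact hpos.ne key

/-- The **Brouwer fixed point theorem** for a bounded continuous map of a Euclidean space. -/
theorem Continuous.exists_fixedPoint_of_norm_le {f : E → E} (hf : Continuous f) {R : ℝ}
    (hR : ∀ x, ‖f x‖ ≤ R) : ∃ x, f x = x := by
  by_contra! hne
  have hRpos : 0 < R := by
    rcases ((norm_nonneg _).trans (hR 0)).lt_or_eq with h | h
    · exact h
    · exact absurd (norm_le_zero_iff.1 (h ▸ hR 0)) (hne 0)
  -- A cutoff equal to 1 for `‖x‖ ≤ 2R` and to 0 for `‖x‖ ≥ 3R`. It creates no fixed point, because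
  -- `‖c x • f x‖ ≤ R`.
  let c : E → ℝ := fun x => max 0 (min 1 (3 - ‖x‖ / R))
  have hc0 : ∀ x, 0 ≤ c x := fun x => le_max_left _ _
  have hc1 : ∀ x, c x ≤ 1 := fun x => max_le zero_le_one (min_le_left _ _)
  have hcc : Continuous c := by fun_prop
  let g : E → E := fun x => c x • f x
  have hg : Continuous g := hcc.smul hf
  have hgne : ∀ x, x ≠ g x := by
    intro x hx
    by_cases h : ‖x‖ ≤ 2 * R
    · have : c x = 1 := by
        have : ‖x‖ / R ≤ 2 := (div_le_iff₀ hRpos).2 h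
        simp only [c]
        rw [min_eq_left (by linarith), max_eq_right zero_le_one]
      simp only [g, this, one_smul] at hx
      exact hne x hx.symm
    · have h1 : ‖g x‖ ≤ R := by
        rw [norm_smul, Real.norm_of_nonneg (hc0 x)]
        exact (mul_le_of_le_one_left (norm_nonneg _) (hc1 x)).trans (hR x)
      rw [← hx] at h1
      linarith
  -- An error smaller than `‖x - g x‖` keeps `p` free of fixed points, and the support condition
  -- makes `p` vanish on the sphere of radius `3R`. Normalizing `x - p x` then gives the forbidden
  -- retraction.
  obtain ⟨p, hp, hpd, hps⟩ := hg.exists_contDiff_approx 1 (ε := fun x => ‖x - g x‖)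
    (by fun_prop) (fun x => norm_pos_iff.2 (sub_ne_zero.2 (hgne x)))
  have hpne : ∀ x, x - p x ≠ 0 := by
    intro x hx
    have := hpd x
    rw [← sub_eq_zero.1 hx, dist_eq_norm] at this
    exact lt_irrefl _ this
  have hpout : ∀ x, ‖x‖ = 3 * R → p x = 0 := by
    intro x hx
    by_contra hpx
    refine hps hpx ?_
    have : c x = 0 := by
      simp only [c]
      rw [hx, mul_div_cancel_right₀ _ hRpos.ne']
      simp
    simp [g, this]
  refine false_of_contDiff_retraction_sphere (E := E) (r := 3 * R)
    (h := fun x => (3 * R / ‖x - p x‖) • (x - p x)) (by positivity) ?_ ?_ ?_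
  · have hd : ContDiff ℝ 1 fun x => x - p x := contDiff_id.sub hp
    exact (contDiff_const.div (hd.norm ℝ hpne) fun x => (norm_pos_iff.2 (hpne x)).ne').smul hd
  · intro x
    have := norm_pos_iff.2 (hpne x)
    rw [norm_smul, Real.norm_of_nonneg (by positivity), div_mul_cancel₀ _ this.ne']
  · intro x hx
    simp only [hpout x hx, sub_zero, hx]
    rw [div_self (by positivity), one_smul]

end Brouwer

/-! ### Zeros of vector fields on a simplex -/

section Simplex

variable {ι : Type*} [Fintype ι]

/-- A retraction of `ι → ℝ` onto the simplex of non-negative vectors of total mass `a`. -/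
noncomputable def simplexRetraction (a : ℝ) (x : ι → ℝ) (i : ι) : ℝ :=
  (max (x i) 0 + max (a - ∑ j, max (x j) 0) 0 / Fintype.card ι) * (a / max a (∑ j, max (x j) 0))

/-- A mass deficit is filled evenly and an excess is scaled away, so the divisor is at least `a`.
Dividing by the mass of the positive part would fail where that mass vanishes. -/
theorem continuous_simplexRetraction {a : ℝ} (ha : 0 < a) :
    Continuous (simplexRetraction a : (ι → ℝ) → ι → ℝ) := by
  refine continuous_pi fun i => ?_
  unfold simplexRetraction
  refine Continuous.mul (by fun_prop) (Continuous.div continuous_const (by fun_prop) fun x => ?_)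
  exact (lt_of_lt_of_le ha (le_max_left _ _)).ne'

theorem simplexRetraction_nonneg {a : ℝ} (ha : 0 < a) (x : ι → ℝ) (i : ι) :
    0 ≤ simplexRetraction a x i := by
  unfold simplexRetraction
  positivity

theorem sum_simplexRetraction [Nonempty ι] {a : ℝ} (ha : 0 < a) (x : ι → ℝ) :
    ∑ i, simplexRetraction a x i = a := by
  unfold simplexRetraction
  rw [← Finset.sum_mul, Finset.sum_add_distrib, Finset.sum_const, Finset.card_univ, nsmul_eq_mul,
    mul_div_cancel₀ _ (by simp : (Fintype.card ι : ℝ) ≠ 0)]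
  set S := ∑ j, max (x j) 0
  have hm : S + max (a - S) 0 = max a S := by
    rcases le_total a S with h | h
    · rw [max_eq_right h, max_eq_right (by linarith), add_zero]
    · rw [max_eq_left h, max_eq_left (by linarith)]; ring
  rw [hm, mul_div_cancel₀ _ (lt_of_lt_of_le ha (le_max_left _ _)).ne']

theorem simplexRetraction_eq_self {a : ℝ} (ha : 0 < a) {x : ι → ℝ} (hx : ∀ i, 0 ≤ x i)
    (hsum : ∑ i, x i = a) : simplexRetraction a x = x := by
  ext i
  have h : ∑ j, max (x j) 0 = a := by
    rw [← hsum]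
    exact Finset.sum_congr rfl fun j _ => max_eq_left (hx j)
  simp [simplexRetraction, h, hx i, ha.ne']

/-- A continuous vector field on a simplex that is tangent to the simplex and does not point inwards
on any face has a zero. -/
theorem exists_zero_of_nonpos_on_faces [Nonempty ι] {a : ℝ} (ha : 0 < a)
    {G : (ι → ℝ) → ι → ℝ} (hG : ContinuousOn G {x | ∀ i, 0 ≤ x i})
    (hsum : ∀ x : ι → ℝ, (∀ i, 0 ≤ x i) → ∑ i, x i = a → ∑ i, G x i = 0)
    (hface : ∀ x : ι → ℝ, (∀ i, 0 ≤ x i) → ∀ i, x i = 0 → G x i ≤ 0) :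
    ∃ x : ι → ℝ, (∀ i, 0 ≤ x i) ∧ G x = 0 := by
  let P : (ι → ℝ) → ℝ := fun y => ∑ j, max (-G y j) 0
  have hP : ∀ y, 0 ≤ P y := fun y => Finset.sum_nonneg fun j _ => le_max_right _ _
  have hden : ∀ y, 0 < 1 + P y / a := fun y => by have := hP y; positivity
  -- The Nash map: push along the positive part of `-G`, then rescale to total mass `a`.
  let Φ : (ι → ℝ) → ι → ℝ := fun y i => (y i + max (-G y i) 0) / (1 + P y / a)
  have hΦ0 : ∀ y : ι → ℝ, (∀ i, 0 ≤ y i) → ∀ i, 0 ≤ Φ y i := fun y hy i =>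
    div_nonneg (add_nonneg (hy i) (le_max_right _ _)) (hden y).le
  have hΦs : ∀ y : ι → ℝ, ∑ i, y i = a → ∑ i, Φ y i = a := by
    intro y hy
    simp only [Φ]
    rw [← Finset.sum_div, Finset.sum_add_distrib, hy, div_eq_iff (hden y).ne']
    simp only [P]
    field_simp
  have hΦc : Continuous fun x => Φ (simplexRetraction a x) := by
    have hGr : Continuous fun x => G (simplexRetraction a x) :=
      hG.comp_continuous (continuous_simplexRetraction ha) fun x => simplexRetraction_nonneg ha x
    have hGi : ∀ i, Continuous fun x => max (-G (simplexRetraction a x) i) 0 := fun i =>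
      (continuous_pi_iff.1 hGr i).neg.max continuous_const
    have hr := continuous_pi_iff.1 (continuous_simplexRetraction (ι := ι) ha)
    refine continuous_pi fun i => Continuous.div ((hr i).add (hGi i)) ?_ fun x => (hden _).ne'
    exact continuous_const.add ((continuous_finsetSum _ fun j _ => hGi j).div_const a)
  let f : EuclideanSpace ℝ ι → EuclideanSpace ℝ ι := fun x =>
    WithLp.toLp 2 (Φ (simplexRetraction a (WithLp.ofLp x)))
  have hf : Continuous f :=
    (PiLp.continuous_toLp 2 _).comp (hΦc.comp (PiLp.continuous_ofLp 2 _))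
  have hfR : ∀ x, ‖f x‖ ≤ √(∑ _i : ι, a ^ 2) := by
    intro x
    have h0 := hΦ0 _ (simplexRetraction_nonneg ha (WithLp.ofLp x))
    have hs := hΦs _ (sum_simplexRetraction ha (WithLp.ofLp x))
    rw [EuclideanSpace.norm_eq]
    refine Real.sqrt_le_sqrt (Finset.sum_le_sum fun i _ => ?_)
    have h1 : f x i ≤ a := by
      rw [← hs]
      exact Finset.single_le_sum (f := Φ (simplexRetraction a (WithLp.ofLp x)))
        (fun j _ => h0 j) (Finset.mem_univ i)
    have h2 : 0 ≤ f x i := h0 i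
    rw [Real.norm_of_nonneg h2]
    gcongr
  obtain ⟨z, hz⟩ := hf.exists_fixedPoint_of_norm_le hfR
  set x : ι → ℝ := WithLp.ofLp z with hx
  have hfix : Φ (simplexRetraction a x) = x := congrArg WithLp.ofLp hz
  have hx0 : ∀ i, 0 ≤ x i := hfix ▸ hΦ0 _ (simplexRetraction_nonneg ha x)
  have hxs : ∑ i, x i = a := by
    rw [← hΦs _ (sum_simplexRetraction ha x), hfix]
  rw [simplexRetraction_eq_self ha hx0 hxs] at hfix
  have hmul : ∀ i, x i * (P x / a) = max (-G x i) 0 := by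
    intro i
    have h1 := congrFun hfix i
    simp only [Φ] at h1
    rw [div_eq_iff (hden x).ne'] at h1
    linarith
  have hzero := hsum x hx0 hxs
  refine ⟨x, hx0, ?_⟩
  -- If `P x > 0`, then `hmul` gives `G x i < 0` where `x i > 0`, and `hface` covers the other
  -- indices. If `P x = 0`, then `G x ≥ 0` has zero sum, so it vanishes.
  have hle : ∀ i, G x i ≤ 0 := by
    rcases (hP x).lt_or_eq with h | h
    · intro i
      rcases (hx0 i).lt_or_eq with hi | hi
      · have h1 : 0 < max (-G x i) 0 := by rw [← hmul i]; positivity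
        rcases lt_max_iff.1 h1 with h2 | h2
        · linarith
        · exact absurd h2 (lt_irrefl _)
      · exact hface x hx0 i hi.symm
    · have hge : ∀ i, 0 ≤ G x i := by
        intro i
        have h1 := hmul i
        rw [← h, zero_div, mul_zero] at h1
        have := le_max_left (-G x i) 0
        linarith
      intro i
      exact ((Finset.sum_eq_zero_iff_of_nonneg fun i _ => hge i).1 hzero i (Finset.mem_univ i)).le
  ext i
  exact (Finset.sum_eq_zero_iff_of_nonpos fun i _ => hle i).1 hzero i (Finset.mem_univ i)

end Simplex

/-! ### Monotonicity of the entropy derivative -/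

section Convexity

variable {H : ℝ → ℝ}

theorem continuousOn_derivWithin_Ici (hH : ContDiffOn ℝ 2 H (Set.Ici 0)) :
    ContinuousOn (derivWithin H (Set.Ici 0)) (Set.Ici 0) :=
  hH.continuousOn_derivWithin (uniqueDiffOn_Ici 0) one_le_two

theorem monotoneOn_derivWithin_Ici (hH : ContDiffOn ℝ 2 H (Set.Ici 0))
    (hH'' : ∀ s : ℝ, 0 < s → 0 < iteratedDerivWithin 2 H (Set.Ici 0) s) :
    MonotoneOn (derivWithin H (Set.Ici 0)) (Set.Ici 0) := by
  have hd : ContDiffOn ℝ 1 (derivWithin H (Set.Ici 0)) (Set.Ici 0) :=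
    hH.derivWithin (uniqueDiffOn_Ici 0) (by norm_num)
  refine monotoneOn_of_deriv_nonneg (convex_Ici 0) hd.continuousOn
    ((hd.differentiableOn one_ne_zero).mono interior_subset) fun x hx => ?_
  rw [interior_Ici] at hx
  have h := hH'' x hx
  rw [iteratedDerivWithin_succ, iteratedDerivWithin_one] at h
  rw [← derivWithin_of_mem_nhds (Ici_mem_nhds hx)]
  exact h.le

end Convexity

/-- Summation by parts against weights `s` whose jumps have the sign opposite to that of `G`. -/
theorem Finset.sum_range_mul_sub_nonneg {n : ℕ} {s G : ℕ → ℝ} (h0 : G 0 = 0) (hn : G n = 0)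
    (h : ∀ k, k + 1 < n → 0 ≤ G (k + 1) * (s k - s (k + 1))) :
    0 ≤ ∑ i ∈ Finset.range n, s i * (G (i + 1) - G i) := by
  rcases n with _ | n
  · simp
  -- The partial sum dominates its boundary term: passing from `j` to `j + 1` costs exactly the
  -- quantity `G (j + 1) * (s j - s (j + 1))`.
  have key : ∀ j, j ≤ n → s j * G (j + 1) ≤
      ∑ i ∈ Finset.range (j + 1), s i * (G (i + 1) - G i) := by
    intro j
    induction j with
    | zero => simp [h0]
    | succ j ih =>
      intro hj
      rw [Finset.sum_range_succ]
      have h1 := ih (by omega)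
      have h2 := h j (by omega)
      linarith
  have := key n le_rfl
  rwa [hn, mul_zero] at this

/-! ### The upwind flux -/

namespace FiniteVolume

namespace Mesh

variable (m : Mesh)

theorem dx_pos : 0 < m.dx := div_pos m.L_pos (Nat.cast_pos.2 m.M_pos)

theorem dt_pos : 0 < m.dt := div_pos m.T_pos (by positivity)

theorem two_mul_M_mul_dx : ((2 * m.M : ℕ) : ℝ) * m.dx = 2 * m.L := by
  have : (m.M : ℝ) ≠ 0 := (Nat.cast_pos.2 m.M_pos).ne'
  unfold dx
  push_cast
  field_simp

variable {m} {H V W : ℝ → ℝ} {c : InteractionChoice} {ρ θ η : m.State}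

theorem flux_zero : m.flux H V W c ρ θ 0 = 0 := by simp [flux]

theorem flux_last : m.flux H V W c ρ θ (2 * m.M) = 0 := by simp [flux]

theorem sum_flux_sub :
    ∑ i : Fin (2 * m.M),
      (m.flux H V W c ρ θ ((i : ℕ) + 1) - m.flux H V W c ρ θ (i : ℕ)) = 0 := by
  rw [Fin.sum_univ_eq_sum_range (fun i => m.flux H V W c ρ θ (i + 1) - m.flux H V W c ρ θ i),
    Finset.sum_range_sub, flux_zero, flux_last, sub_zero]

theorem flux_of_lt {k : ℕ} (hk : k + 1 < 2 * m.M) :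
    m.flux H V W c ρ θ (k + 1) =
      θ ⟨k, by omega⟩ * max (-((m.entropyVar H V W c ρ θ ⟨k + 1, hk⟩
          - m.entropyVar H V W c ρ θ ⟨k, by omega⟩) / m.dx)) 0
        + θ ⟨k + 1, hk⟩ * min (-((m.entropyVar H V W c ρ θ ⟨k + 1, hk⟩
          - m.entropyVar H V W c ρ θ ⟨k, by omega⟩) / m.dx)) 0 := by
  simp [flux, hk]

/-- Upwinding: a flux to the right would be carried by the density of the empty cell, so only inflow
from the right neighbour remains. The next lemma is its mirror image. -/
theorem flux_succ_nonpos (hθ : ∀ i, 0 ≤ θ i) {i : Fin (2 * m.M)} (hi : θ i = 0) :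
    m.flux H V W c ρ θ ((i : ℕ) + 1) ≤ 0 := by
  by_cases h : (i : ℕ) + 1 < 2 * m.M
  · rw [flux_of_lt h, hi, zero_mul, zero_add]
    exact mul_nonpos_of_nonneg_of_nonpos (hθ _) (min_le_right _ _)
  · rw [show (i : ℕ) + 1 = 2 * m.M by omega, flux_last]

theorem flux_nonneg (hθ : ∀ i, 0 ≤ θ i) {i : Fin (2 * m.M)} (hi : θ i = 0) :
    0 ≤ m.flux H V W c ρ θ (i : ℕ) := by
  obtain ⟨_ | k, hk⟩ := i
  · exact flux_zero.ge
  · rw [flux_of_lt hk, hi, zero_mul, add_zero]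
    exact mul_nonneg (hθ _) (le_max_right _ _)

theorem flux_eq_zero_of_eq_zero (k : ℕ) : m.flux H V W c ρ 0 k = 0 := by
  simp [flux]

theorem continuousOn_entropyVar (hH : ContDiffOn ℝ 2 H (Set.Ici 0)) (i : Fin (2 * m.M)) :
    ContinuousOn (fun θ => m.entropyVar H V W c ρ θ i) {θ | ∀ i, 0 ≤ θ i} := by
  have h1 : ContinuousOn (fun θ : m.State => derivWithin H (Set.Ici 0) (θ i))
      {θ | ∀ i, 0 ≤ θ i} :=
    (continuousOn_derivWithin_Ici hH).comp (continuous_apply i).continuousOn fun θ hθ => hθ i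
  have h2 : Continuous fun θ : m.State => m.conv W (c.density ρ θ) i := by
    unfold conv
    cases c <;> simp only [InteractionChoice.density] <;> fun_prop
  exact (h1.add continuousOn_const).add h2.continuousOn

theorem continuousOn_flux (hH : ContDiffOn ℝ 2 H (Set.Ici 0)) (k : ℕ) :
    ContinuousOn (fun θ => m.flux H V W c ρ θ k) {θ | ∀ i, 0 ≤ θ i} := by
  unfold flux
  split_ifs with h
  · have hl := continuousOn_entropyVar (V := V) (W := W) (c := c) (ρ := ρ) hH ⟨k - 1, by omega⟩
    have hr := continuousOn_entropyVar (V := V) (W := W) (c := c) (ρ := ρ) hH ⟨k, h.2⟩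
    fun_prop
  · exact continuousOn_const

/-! ### One time step: existence -/

/-- `θ` is obtained from `ρ` by one step of the implicit scheme. -/
def IsStep (m : Mesh) (H V W : ℝ → ℝ) (c : InteractionChoice) (ρ θ : m.State) : Prop :=
  ∀ i : Fin (2 * m.M), (θ i - ρ i) / m.dt =
    -((m.flux H V W c ρ θ ((i : ℕ) + 1) - m.flux H V W c ρ θ (i : ℕ)) / m.dx)

/-- The residual of one step of the implicit scheme. -/
noncomputable def residual (m : Mesh) (H V W : ℝ → ℝ) (c : InteractionChoice) (ρ θ : m.State) : m.State :=
  fun i => θ i - ρ i +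
    m.dt / m.dx * (m.flux H V W c ρ θ ((i : ℕ) + 1) - m.flux H V W c ρ θ (i : ℕ))

theorem isStep_iff_residual_eq_zero :
    m.IsStep H V W c ρ θ ↔ m.residual H V W c ρ θ = 0 := by
  rw [funext_iff]
  refine forall_congr' fun i => ?_
  have h1 := m.dx_pos.ne'
  have h2 := m.dt_pos.ne'
  simp only [residual, Pi.zero_apply]
  rw [div_eq_iff h2, eq_comm, ← sub_eq_zero, eq_comm, ← neg_eq_zero, eq_comm]
  constructor <;> intro h <;> rw [← h] <;> field_simp <;> ring

theorem sum_residual : ∑ i, m.residual H V W c ρ θ i = ∑ i, θ i - ∑ i, ρ i := by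
  unfold residual
  rw [Finset.sum_add_distrib, ← Finset.mul_sum, sum_flux_sub, mul_zero, add_zero,
    Finset.sum_sub_distrib]

theorem IsStep.sum_eq (h : m.IsStep H V W c ρ θ) : ∑ i, θ i = ∑ i, ρ i := by
  have := sum_residual (H := H) (V := V) (W := W) (c := c) (ρ := ρ) (θ := θ)
  rw [isStep_iff_residual_eq_zero.1 h] at this
  simp only [Pi.zero_apply, Finset.sum_const_zero] at this
  linarith

/-- The simplex argument applied to the residual. On the face `θ i = 0` the flux signs leave at most
`-ρ i ≤ 0`. Zero mass, where the simplex degenerates to a point, is treated apart. -/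
theorem exists_isStep (hH : ContDiffOn ℝ 2 H (Set.Ici 0)) (hρ : ∀ i, 0 ≤ ρ i) :
    ∃ θ : m.State, (∀ i, 0 ≤ θ i) ∧ m.IsStep H V W c ρ θ := by
  have hpos := m.M_pos
  have : Nonempty (Fin (2 * m.M)) := ⟨⟨0, by omega⟩⟩
  rcases (Finset.sum_nonneg fun i _ => hρ i : 0 ≤ ∑ i, ρ i).lt_or_eq with ha | ha
  · have hlam : 0 < m.dt / m.dx := div_pos m.dt_pos m.dx_pos
    simp only [isStep_iff_residual_eq_zero]
    refine exists_zero_of_nonpos_on_faces ha ?_ ?_ ?_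
    · refine continuousOn_pi.2 fun i => ?_
      have h1 := continuousOn_flux (V := V) (W := W) (c := c) (ρ := ρ) hH ((i : ℕ) + 1)
      have h2 := continuousOn_flux (V := V) (W := W) (c := c) (ρ := ρ) hH (i : ℕ)
      unfold residual
      fun_prop
    · intro θ _ hs
      rw [sum_residual, hs, sub_self]
    · intro θ hθ i hi
      have h1 := flux_succ_nonpos (H := H) (V := V) (W := W) (c := c) (ρ := ρ) hθ hi
      have h2 := flux_nonneg (H := H) (V := V) (W := W) (c := c) (ρ := ρ) hθ hi
      have h3 := mul_nonpos_of_nonneg_of_nonpos hlam.le (sub_nonpos.2 (h1.trans h2))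
      have h4 := hρ i
      simp only [residual]
      linarith
  · have h0 : ∀ i, ρ i = 0 := fun i =>
      (Finset.sum_eq_zero_iff_of_nonneg fun i _ => hρ i).1 ha.symm i (Finset.mem_univ i)
    refine ⟨0, fun i => le_rfl, fun i => ?_⟩
    simp [h0, flux_eq_zero_of_eq_zero]

/-! ### One time step: comparison and uniqueness -/

/-- With a common `b`, the velocity depends on the densities only through `H'`, so raising the left
density or lowering the right one raises it. Both upwind products then move in the same direction.
-/
theorem flux_le_flux (hmono : MonotoneOn (derivWithin H (Set.Ici 0)) (Set.Ici 0))
    {b : m.State} (hbθ : ∀ i, m.entropyVar H V W c ρ θ i = derivWithin H (Set.Ici 0) (θ i) + b i)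
    (hbη : ∀ i, m.entropyVar H V W c ρ η i = derivWithin H (Set.Ici 0) (η i) + b i)
    (hθ : ∀ i, 0 ≤ θ i) (hη : ∀ i, 0 ≤ η i) {k : ℕ} (hk : k + 1 < 2 * m.M)
    (hl : θ ⟨k, by omega⟩ ≤ η ⟨k, by omega⟩) (hr : η ⟨k + 1, hk⟩ ≤ θ ⟨k + 1, hk⟩) :
    m.flux H V W c ρ θ (k + 1) ≤ m.flux H V W c ρ η (k + 1) := by
  rw [flux_of_lt hk, flux_of_lt hk]
  have hu : -((m.entropyVar H V W c ρ θ ⟨k + 1, hk⟩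
      - m.entropyVar H V W c ρ θ ⟨k, by omega⟩) / m.dx) ≤
      -((m.entropyVar H V W c ρ η ⟨k + 1, hk⟩
      - m.entropyVar H V W c ρ η ⟨k, by omega⟩) / m.dx) := by
    rw [hbθ, hbθ, hbη, hbη]
    have h1 := hmono (hθ _) (hη _) hl
    have h2 := hmono (hη _) (hθ _) hr
    have := m.dx_pos
    refine neg_le_neg (div_le_div_of_nonneg_right ?_ this.le)
    linarith
  set u := -((m.entropyVar H V W c ρ θ ⟨k + 1, hk⟩
      - m.entropyVar H V W c ρ θ ⟨k, by omega⟩) / m.dx)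
  set w := -((m.entropyVar H V W c ρ η ⟨k + 1, hk⟩
      - m.entropyVar H V W c ρ η ⟨k, by omega⟩) / m.dx)
  refine add_le_add ?_ ?_
  · exact mul_le_mul hl (max_le_max hu le_rfl) (le_max_right _ _) (hη _)
  · exact (mul_le_mul_of_nonpos_right hr (min_le_right _ _)).trans
      (mul_le_mul_of_nonneg_left (min_le_min hu le_rfl) (hη _))

/-- Comparison principle for one step, when the interaction term does not depend on `ρ^{n+1}`. -/
theorem IsStep.le (hmono : MonotoneOn (derivWithin H (Set.Ici 0)) (Set.Ici 0))
    {b : m.State}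
    (hb : ∀ θ i, m.entropyVar H V W c ρ θ i = derivWithin H (Set.Ici 0) (θ i) + b i)
    (hθ : ∀ i, 0 ≤ θ i) (hη : ∀ i, 0 ≤ η i)
    (hsθ : m.IsStep H V W c ρ θ) (hsη : m.IsStep H V W c ρ η) (i : Fin (2 * m.M)) :
    θ i ≤ η i := by
  classical
  -- The test function is the indicator of `η < θ`. Its default value beyond the last cell is never
  -- used.
  let s : ℕ → ℝ := fun k => if h : k < 2 * m.M then (if η ⟨k, h⟩ < θ ⟨k, h⟩ then 1 else 0) else 0
  let G : ℕ → ℝ := fun k => m.flux H V W c ρ θ k - m.flux H V W c ρ η k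
  have hsG : 0 ≤ ∑ i ∈ Finset.range (2 * m.M), s i * (G (i + 1) - G i) := by
    refine Finset.sum_range_mul_sub_nonneg (by simp [G, flux_zero]) (by simp [G, flux_last]) ?_
    intro k hk
    have hk' : k < 2 * m.M := by omega
    -- Only interfaces where the order of `θ` and `η` switches contribute, and there `flux_le_flux`
    -- gives the sign.
    simp only [s, G, hk, hk', dif_pos]
    split_ifs with h1 h2 h2
    · simp
    · have := flux_le_flux hmono (hb η) (hb θ) hη hθ hk h1.le (not_lt.1 h2)
      linarith
    · have := flux_le_flux hmono (hb θ) (hb η) hθ hη hk (not_lt.1 h1) h2.le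
      linarith
    · simp
  rw [← Fin.sum_univ_eq_sum_range (fun i => s i * (G (i + 1) - G i))] at hsG
  have hterm : ∀ i : Fin (2 * m.M), max (θ i - η i) 0 =
      -(m.dt / m.dx * (s i * (G ((i : ℕ) + 1) - G i))) := by
    intro i
    have h1 := congrFun (isStep_iff_residual_eq_zero.1 hsθ) i
    have h2 := congrFun (isStep_iff_residual_eq_zero.1 hsη) i
    simp only [residual, Pi.zero_apply] at h1 h2
    have h3 : θ i - η i = -(m.dt / m.dx * (G ((i : ℕ) + 1) - G i)) := by
      simp only [G]
      linear_combination h1 - h2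
    simp only [s, i.isLt, dif_pos, Fin.eta]
    split_ifs with h
    · rw [max_eq_left (by linarith), h3, one_mul]
    · rw [max_eq_right (by linarith)]
      simp
  have hsum : ∑ i, max (θ i - η i) 0 ≤ 0 := by
    simp_rw [hterm]
    rw [Finset.sum_neg_distrib, ← Finset.mul_sum]
    have := mul_nonneg (div_pos m.dt_pos m.dx_pos).le hsG
    linarith
  have := (Finset.single_le_sum (f := fun i => max (θ i - η i) 0)
    (fun j _ => le_max_right _ _) (Finset.mem_univ i)).trans hsum
  have h2 := (le_max_left (θ i - η i) 0).trans this
  linarith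

/-! ### Geometry of the cells and the two uniqueness cases -/

theorem measurableSet_cell (i : Fin (2 * m.M)) : MeasurableSet (m.cell i) := measurableSet_Ico

/-- A centre is at least `Δx / 2` away from both ends of the domain, so the kernel samples `W` only
in the open interval. -/
theorem center_sub_mem_Ioo (i j : Fin (2 * m.M)) {s : ℝ} (hs : s ∈ m.cell j) :
    m.center i - s ∈ Set.Ioo (-(2 * m.L)) (2 * m.L) := by
  have hdx := m.dx_pos
  have hL := m.two_mul_M_mul_dx
  have hi : (i : ℝ) + 1 ≤ ((2 * m.M : ℕ) : ℝ) := by exact_mod_cast i.isLt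
  have hj : (j : ℝ) + 1 ≤ ((2 * m.M : ℕ) : ℝ) := by exact_mod_cast j.isLt
  have hi' := mul_le_mul_of_nonneg_right hi hdx.le
  have hj' := mul_le_mul_of_nonneg_right hj hdx.le
  have hi0 : 0 ≤ (i : ℝ) * m.dx := by positivity
  have hj0 : 0 ≤ (j : ℝ) * m.dx := by positivity
  obtain ⟨h1, h2⟩ := hs
  simp only [center]
  constructor <;> linarith

theorem kernel_eq_zero (hW : ∀ x ∈ Set.Ioo (-(2 * m.L)) (2 * m.L), W x = 0)
    (i j : Fin (2 * m.M)) : m.kernel W i j = 0 := by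
  unfold kernel
  rw [setAverage_eq, setIntegral_congr_fun (g := fun _ => 0) (measurableSet_cell j)
    fun s hs => hW _ (center_sub_mem_Ioo i j hs)]
  simp

/-- Both uniqueness cases amount to this: everything but `H'` is independent of the new density. -/
theorem exists_entropyVar_eq
    (h : c = .old ∨ ∀ x ∈ Set.Ioo (-(2 * m.L)) (2 * m.L), W x = 0) (ρ : m.State) :
    ∃ b : m.State, ∀ θ i, m.entropyVar H V W c ρ θ i = derivWithin H (Set.Ici 0) (θ i) + b i := by
  rcases h with rfl | h
  · exact ⟨fun i => m.cellAverage V i + m.conv W ρ i, fun θ i => by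
      simp only [entropyVar, InteractionChoice.density]; ring⟩
  · exact ⟨m.cellAverage V, fun θ i => by simp [entropyVar, conv, kernel_eq_zero h]⟩

theorem IsStep.unique (hH : ContDiffOn ℝ 2 H (Set.Ici 0))
    (hH'' : ∀ s : ℝ, 0 < s → 0 < iteratedDerivWithin 2 H (Set.Ici 0) s)
    (h : c = .old ∨ ∀ x ∈ Set.Ioo (-(2 * m.L)) (2 * m.L), W x = 0)
    (hθ : ∀ i, 0 ≤ θ i) (hη : ∀ i, 0 ≤ η i)
    (hsθ : m.IsStep H V W c ρ θ) (hsη : m.IsStep H V W c ρ η) : θ = η := by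
  have hmono := monotoneOn_derivWithin_Ici hH hH''
  obtain ⟨b, hb⟩ := exists_entropyVar_eq (H := H) (V := V) h ρ
  ext i
  exact le_antisymm (IsStep.le hmono hb hθ hη hsθ hsη i) (IsStep.le hmono hb hη hθ hsη hsθ i)

/-! ### Mass and L¹ norm of the interpolation -/

/-- The half-open cells tile `[-L, L)`, which exceeds the open domain by a null set. -/
theorem domain_ae_eq (m : Mesh) : (m.domain : Set ℝ) =ᵐ[volume] Set.Ico (-m.L) m.L := Ioo_ae_eq_Ico

theorem cell_subset (i : Fin (2 * m.M)) : m.cell i ⊆ Set.Ico (-m.L) m.L := by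
  have hdx := m.dx_pos
  have hL := m.two_mul_M_mul_dx
  have hi : (i : ℝ) + 1 ≤ ((2 * m.M : ℕ) : ℝ) := by exact_mod_cast i.isLt
  have hi' := mul_le_mul_of_nonneg_right hi hdx.le
  have hi0 : 0 ≤ (i : ℝ) * m.dx := by positivity
  rintro s ⟨h1, h2⟩
  constructor <;> linarith

theorem volume_real_cell (i : Fin (2 * m.M)) : volume.real (m.cell i) = m.dx := by
  have := m.dx_pos
  unfold cell
  rw [Real.volume_real_Ico_of_le] <;> linarith

theorem cellAverage_mul_dx (f : ℝ → ℝ) (i : Fin (2 * m.M)) :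
    m.cellAverage f i * m.dx = ∫ x in m.cell i, f x := by
  have := m.dx_pos.ne'
  rw [cellAverage, setAverage_eq, volume_real_cell, smul_eq_mul]
  field_simp

theorem cellAverage_nonneg {f : ℝ → ℝ} (hf : ∀ᵐ x ∂(volume.restrict m.domain), 0 ≤ f x)
    (i : Fin (2 * m.M)) : 0 ≤ m.cellAverage f i := by
  rw [Measure.restrict_congr_set m.domain_ae_eq] at hf
  have h := ae_restrict_of_ae_restrict_of_subset (cell_subset i) hf
  rw [cellAverage, setAverage_eq]
  exact smul_nonneg (inv_nonneg.2 measureReal_nonneg) (integral_nonneg_of_ae h)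

theorem sum_cellAverage_mul_dx {f : ℝ → ℝ} (hf : IntegrableOn f m.domain) :
    ∑ i, m.cellAverage f i * m.dx = ∫ x in m.domain, f x := by
  have hdx := m.dx_pos
  have hf' : IntegrableOn f (Set.Ico (-m.L) m.L) := hf.congr_set_ae m.domain_ae_eq.symm
  let a : ℕ → ℝ := fun k => -m.L + (k : ℝ) * m.dx
  have ha : ∀ k, a k ≤ a (k + 1) := fun k => by
    simp only [a]; push_cast; linarith
  have hcell : ∀ i : Fin (2 * m.M), m.cell i = Set.Ico (a i) (a ((i : ℕ) + 1)) := fun i => by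
    simp [cell, a]
  have hint : ∀ k < 2 * m.M, IntervalIntegrable f volume (a k) (a (k + 1)) := by
    intro k hk
    rw [intervalIntegrable_iff_integrableOn_Ico_of_le (ha k)]
    have := hf'.mono_set (cell_subset ⟨k, hk⟩)
    rwa [hcell] at this
  have hsum := intervalIntegral.sum_integral_adjacent_intervals hint
  have h0 : a 0 = -m.L := by simp [a]
  have hn : a (2 * m.M) = m.L := by
    simp only [a]; rw [m.two_mul_M_mul_dx]; ring
  rw [h0, hn, intervalIntegral.integral_of_le (by linarith [m.L_pos])] at hsum
  rw [domain, ← integral_Ioc_eq_integral_Ioo, ← hsum,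
    ← Fin.sum_univ_eq_sum_range (fun k => ∫ x in a k..a (k + 1), f x)]
  refine Finset.sum_congr rfl fun i _ => ?_
  rw [cellAverage_mul_dx, hcell, intervalIntegral.integral_of_le (ha i),
    integral_Ico_eq_integral_Ioc]

theorem exists_mem_timeInterval {t : ℝ} (ht : t ∈ Set.Icc 0 m.T) :
    ∃ n : Fin (m.N + 2), ∀ k : Fin (m.N + 2), t ∈ m.timeInterval (k : ℕ) ↔ k = n := by
  have hdt := m.dt_pos
  have hT : m.T / m.dt = m.N + 1 := by
    have := m.T_pos.ne'
    unfold dt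
    field_simp
  have h0 : 0 ≤ t / m.dt := div_nonneg ht.1 hdt.le
  -- At `t = T` the floor equals `N + 1`, the extra last level.
  have hlt : ⌊t / m.dt⌋₊ < m.N + 2 := by
    rw [Nat.floor_lt h0]
    have : t / m.dt ≤ m.T / m.dt := by gcongr; exact ht.2
    rw [hT] at this
    push_cast
    linarith
  refine ⟨⟨⌊t / m.dt⌋₊, hlt⟩, fun k => ?_⟩
  rw [Fin.ext_iff, eq_comm, Nat.floor_eq_iff h0, timeInterval, Set.mem_Ico, le_div_iff₀ hdt,
    div_lt_iff₀ hdt]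

theorem integral_sum_indicator_cell (θ : m.State) :
    ∫ x in m.domain, ∑ i, (m.cell i).indicator (fun _ => θ i) x = ∑ i, θ i * m.dx := by
  rw [setIntegral_congr_set m.domain_ae_eq, integral_finsetSum]
  · refine Finset.sum_congr rfl fun i _ => ?_
    rw [setIntegral_indicator (measurableSet_cell i), Set.inter_eq_right.2 (cell_subset i),
      setIntegral_const, volume_real_cell, smul_eq_mul, mul_comm]
  · intro i _
    exact (integrable_const (θ i)).indicator (measurableSet_cell i)

theorem eLpNorm_one_eq_ofReal_integral {α : Type*} [MeasurableSpace α] {μ : Measure α}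
    {f : α → ℝ} (hf : Integrable f μ) (h0 : 0 ≤ᵐ[μ] f) :
    eLpNorm f 1 μ = ENNReal.ofReal (∫ x, f x ∂μ) := by
  rw [eLpNorm_one_eq_lintegral_enorm, ← ofReal_integral_norm_eq_lintegral_enorm hf]
  congr 1
  refine integral_congr_ae ?_
  filter_upwards [h0] with x hx using Real.norm_of_nonneg hx

theorem eLpNorm_sum_indicator_cell (hθ : ∀ i, 0 ≤ θ i) :
    eLpNorm (fun x => ∑ i, (m.cell i).indicator (fun _ => θ i) x) 1 (volume.restrict m.domain) =
      ENNReal.ofReal (∑ i, θ i * m.dx) := by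
  rw [← integral_sum_indicator_cell]
  refine eLpNorm_one_eq_ofReal_integral ?_ (Filter.Eventually.of_forall fun x => ?_)
  · have : IsFiniteMeasure (volume.restrict m.domain) := by
      unfold domain; infer_instance
    exact integrable_finsetSum _ fun i _ =>
      (integrable_const (θ i)).indicator (measurableSet_cell i)
  · exact Finset.sum_nonneg fun i _ => Set.indicator_nonneg (fun _ _ => hθ i) x

/-! ### Iteration in time -/

variable {ρ₀ : ℝ → ℝ} {r : Fin (m.N + 2) → m.State}

theorem IsSolution.sum_eq (h : m.IsSolution H V W c ρ₀ r) (n : Fin (m.N + 2)) :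
    ∑ i, r n i = ∑ i, m.cellAverage ρ₀ i := by
  induction n using Fin.induction with
  | zero => rw [h.initial]
  | succ n ih => rw [IsStep.sum_eq (h.step n), ih]

theorem IsNonnegSolution.eLpNorm_interpolation (h : m.IsNonnegSolution H V W c ρ₀ r)
    (hρ₀ : IntegrableOn ρ₀ m.domain) (h0 : ∀ᵐ x ∂(volume.restrict m.domain), 0 ≤ ρ₀ x)
    {t : ℝ} (ht : t ∈ Set.Icc 0 m.T) :
    eLpNorm (m.interpolation r t) 1 (volume.restrict m.domain) =
      eLpNorm ρ₀ 1 (volume.restrict m.domain) := by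
  obtain ⟨n, hn⟩ := exists_mem_timeInterval ht
  have hi : m.interpolation r t = fun x => ∑ i, (m.cell i).indicator (fun _ => r n i) x := by
    classical
    ext x
    unfold interpolation
    rw [Finset.sum_eq_single n]
    · refine Finset.sum_congr rfl fun i _ => ?_
      simp [(hn n).2 rfl, Set.indicator]
    · intro k _ hk
      simp [mt (hn k).1 hk]
    · simp
  rw [hi, eLpNorm_sum_indicator_cell (h.2 n), eLpNorm_one_eq_ofReal_integral hρ₀ h0,
    ← sum_cellAverage_mul_dx hρ₀, ← Finset.sum_mul, ← Finset.sum_mul, h.1.sum_eq n]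

theorem exists_isNonnegSolution (hH : ContDiffOn ℝ 2 H (Set.Ici 0))
    (h0 : ∀ᵐ x ∂(volume.restrict m.domain), 0 ≤ ρ₀ x) :
    ∃ r : Fin (m.N + 2) → m.State, m.IsNonnegSolution H V W c ρ₀ r := by
  -- A step exists only from a non-negative density, so non-negativity has to be propagated along
  -- the iteration.
  choose! next hnext hstep using fun (ρ : m.State) (hρ : ∀ i, 0 ≤ ρ i) =>
    exists_isStep (V := V) (W := W) (c := c) hH hρ
  let r : ℕ → m.State := fun n => next^[n] (m.cellAverage ρ₀)
  have hr : ∀ n i, 0 ≤ r n i := by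
    intro n
    induction n with
    | zero => exact cellAverage_nonneg h0
    | succ n ih =>
      simp only [r, Function.iterate_succ_apply'] at ih ⊢
      exact hnext _ ih
  refine ⟨fun n => r n, ⟨rfl, fun n => ?_⟩, fun n => hr n⟩
  have h1 : r ((n.succ : Fin (m.N + 2)) : ℕ) = next (r n) := by
    simp only [r, Fin.val_succ, Function.iterate_succ_apply']
  simp only [h1, Fin.val_castSucc]
  exact hstep _ (hr n)

theorem IsNonnegSolution.unique {r' : Fin (m.N + 2) → m.State}
    (hH : ContDiffOn ℝ 2 H (Set.Ici 0))
    (hH'' : ∀ s : ℝ, 0 < s → 0 < iteratedDerivWithin 2 H (Set.Ici 0) s)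
    (hc : c = .old ∨ ∀ x ∈ Set.Ioo (-(2 * m.L)) (2 * m.L), W x = 0)
    (h : m.IsNonnegSolution H V W c ρ₀ r) (h' : m.IsNonnegSolution H V W c ρ₀ r') : r = r' := by
  ext1 n
  induction n using Fin.induction with
  | zero => rw [h.1.initial, h'.1.initial]
  | succ n ih =>
    refine IsStep.unique hH hH'' hc (h.2 _) (h'.2 _) (h.1.step n) ?_
    rw [ih]
    exact h'.1.step n

end Mesh

end FiniteVolume

theorem theorem3p1 (m : FiniteVolume.Mesh) (H V W : ℝ → ℝ)
    (hH : ContDiffOn ℝ 2 H (Set.Ici 0))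
    (hH'' : ∀ s : ℝ, 0 < s → 0 < iteratedDerivWithin 2 H (Set.Ici 0) s)
    (hV : IntegrableOn V (Set.Ioo (-m.L) m.L))
    (hW : IntegrableOn W (Set.Ioo (-(2 * m.L)) (2 * m.L)))
    (c : FiniteVolume.InteractionChoice)
    (ρ₀ : ℝ → ℝ) (hρ₀ : IntegrableOn ρ₀ m.domain)
    (hρ₀_nonneg : ∀ᵐ x ∂(volume.restrict m.domain), 0 ≤ ρ₀ x) :
    (∃ ρ : Fin (m.N + 2) → m.State, m.IsNonnegSolution H V W c ρ₀ ρ) ∧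
    (∀ ρ : Fin (m.N + 2) → m.State, m.IsNonnegSolution H V W c ρ₀ ρ →
      ∀ t ∈ Set.Icc 0 m.T,
        eLpNorm (m.interpolation ρ t) 1 (volume.restrict m.domain) =
          eLpNorm ρ₀ 1 (volume.restrict m.domain)) ∧
    (c = .old ∨ (∀ x ∈ Set.Ioo (-(2 * m.L)) (2 * m.L), W x = 0) →
      ∃! ρ : Fin (m.N + 2) → m.State, m.IsNonnegSolution H V W c ρ₀ ρ) := by
  have hex := FiniteVolume.Mesh.exists_isNonnegSolution (V := V) (W := W) (c := c) hH hρ₀_nonneg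
  refine ⟨hex, fun ρ hρ t ht => hρ.eLpNorm_interpolation hρ₀ hρ₀_nonneg ht, fun hc => ?_⟩
  obtain ⟨ρ, hρ⟩ := hex
  exact ⟨ρ, hρ, fun ρ' hρ' => hρ'.unique hH hH'' hc hρ⟩
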